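/- Let $\mathcal K$ be a field of characteristic $0$ with a derivation $\partial$, and let $\mathcal K[\partial]$ be the ring of (formal) differential operators $\sum_i a_i\partial^i$, $a_i\in\mathcal K$, with $\partial\circ a=a\,\partial+a'$. Let $n\ge 0$. For $A\in M_n(\mathcal K[\partial])$ let $\det A$ be its Dieudonné determinant, taken over the skewfield of fractions of $\mathcal K[\partial]$: it is $0$ or of the form $a\lambda^{d}$ with $a\in\mathcal K\setminus\{0\}$, $d\in\mathbb Z$; it is multiplicative, and for an upper triangular matrix it is the product of the symbols of the diagonal entries, where $a\,\partial^d+(\text{terms of lower order})$ with $a\ne 0$ has symbol $a\lambda^d$ and $0$ has symbol $0$. Let $\ker A=\{F\in\mathcal K^n : A(\partial)F=0\}$. Theorem. For all $A,B\in M_n(\mathcal K[\partial])$ with $\det B\neq 0$ there exist $A_1,B_1,D\in M_n(\mathcal K[\partial])$ with $\det B_1\neq 0$ and $\det D\neq 0$ such that (i) $A=A_1D$ and $B=B_1D$; (ii) $\ker A_1\cap\ker B_1=0$ in $\mathcal K^n$. -/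

import Mathlib

open Polynomial
open scoped nonZeroDivisors

/-- Differential operators `∑ aᵢ ∂ⁱ` over `K`, with coefficients written on the left.  The operator
`∑ aᵢ ∂ⁱ` is stored as the polynomial `∑ aᵢ Xⁱ`; the multiplication defined below is the
noncommutative one, determined by `∂ a = a ∂ + a′`, and not that of `K[X]`.  The operators are
formal: they form a left `K`-vector space with basis `1, ∂, ∂², …`, whatever the derivation is. -/
@[ext]
structure DiffOp (K : Type*) [Field K] where
  toPoly : K[X]

namespace DiffOp

noncomputable section

section Additive

variable {K : Type*} [Field K]

/-- The bijection with the polynomials that transports addition. -/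
def equivPoly : DiffOp K ≃ K[X] where
  toFun := toPoly
  invFun := mk
  left_inv _ := rfl
  right_inv _ := rfl

instance : AddCommGroup (DiffOp K) := equivPoly.addCommGroup

theorem toPoly_add (P Q : DiffOp K) : (P + Q).toPoly = P.toPoly + Q.toPoly := rfl

theorem toPoly_sub (P Q : DiffOp K) : (P - Q).toPoly = P.toPoly - Q.toPoly := rfl

theorem toPoly_zero : (0 : DiffOp K).toPoly = 0 := rfl

instance : One (DiffOp K) := ⟨⟨1⟩⟩

theorem toPoly_one : (1 : DiffOp K).toPoly = 1 := rfl

end Additive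

variable {K : Type*} [Field K] [Differential K]

/-- `∑ bⱼ ∂ʲ ↦ ∂ ∘ (∑ bⱼ ∂ʲ) = ∑ (bⱼ ∂ʲ⁺¹ + bⱼ′ ∂ʲ)`. -/
def dMul : Module.End ℤ K[X] :=
  LinearMap.mulLeft ℤ (X : K[X]) + (Differential.mapCoeffs (A := K)).toLinearMap

theorem dMul_apply (q : K[X]) : dMul q = X * q + Differential.mapCoeffs q := rfl

/-- `mulPoly p q` represents the composition of the operators represented by `p` and `q`:
`(∑ aᵢ ∂ⁱ) ∘ Q = ∑ aᵢ (∂ⁱ ∘ Q)`. -/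
def mulPoly (p : K[X]) : Module.End ℤ K[X] :=
  p.sum fun i a => LinearMap.mulLeft ℤ (C a) * dMul ^ i

theorem mulPoly_add (p q : K[X]) : mulPoly (p + q) = mulPoly p + mulPoly q :=
  Polynomial.sum_add_index p q _
    (fun i => by ext1 x; simp)
    (fun i a b => by ext1 x; simp [add_mul])

theorem mulPoly_zero : mulPoly (0 : K[X]) = 0 := Polynomial.sum_zero_index _

theorem mulPoly_monomial (i : ℕ) (a : K) :
    mulPoly (monomial i a) = LinearMap.mulLeft ℤ (C a) * dMul ^ i :=
  Polynomial.sum_monomial_index a _ (by ext1 x; simp)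

theorem mulPoly_one : mulPoly (1 : K[X]) = 1 := by
  rw [← monomial_zero_one, mulPoly_monomial]; ext1 x; simp

theorem dMul_pow_one (i : ℕ) : (dMul ^ i : Module.End ℤ K[X]) 1 = X ^ i := by
  induction i with
  | zero => simp
  | succ k ih =>
    rw [pow_succ', Module.End.mul_apply, ih, dMul_apply, pow_succ']
    have : Differential.mapCoeffs (X ^ k : K[X]) = 0 := by
      rw [← monomial_one_right_eq_X_pow, Differential.mapCoeffs_monomial]; simp
    rw [this, add_zero]

theorem mulPoly_apply_one (p : K[X]) : mulPoly p 1 = p := by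
  induction p using Polynomial.induction_on' with
  | add p q hp hq => rw [mulPoly_add, LinearMap.add_apply, hp, hq]
  | monomial i a =>
    rw [mulPoly_monomial, Module.End.mul_apply, dMul_pow_one, LinearMap.mulLeft_apply,
      C_mul_X_pow_eq_monomial]

theorem mulPoly_dMul (q : K[X]) : mulPoly (dMul q) = dMul * mulPoly q := by
  induction q using Polynomial.induction_on' with
  | add p q hp hq => rw [map_add, mulPoly_add, hp, hq, mulPoly_add, mul_add]
  | monomial i a =>
    rw [dMul_apply, X_mul_monomial, Differential.mapCoeffs_monomial, mulPoly_add,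
      mulPoly_monomial, mulPoly_monomial, mulPoly_monomial]
    ext1 x
    simp only [LinearMap.add_apply, Module.End.mul_apply, LinearMap.mulLeft_apply, dMul_apply,
      pow_succ', Derivation.leibniz, Differential.mapCoeffs_C, smul_eq_mul]
    ring

theorem mulPoly_C_mul (a : K) (q : K[X]) :
    mulPoly (C a * q) = LinearMap.mulLeft ℤ (C a) * mulPoly q := by
  induction q using Polynomial.induction_on' with
  | add p q hp hq => rw [mul_add, mulPoly_add, hp, hq, mulPoly_add, mul_add]
  | monomial i b =>
    rw [C_mul_monomial, mulPoly_monomial, mulPoly_monomial]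
    ext1 x
    simp

theorem mulPoly_mulPoly (p q : K[X]) : mulPoly (mulPoly p q) = mulPoly p * mulPoly q := by
  induction p using Polynomial.induction_on' with
  | add p p' hp hq => rw [mulPoly_add, LinearMap.add_apply, mulPoly_add, hp, hq, add_mul]
  | monomial i a =>
    rw [mulPoly_monomial, Module.End.mul_apply, LinearMap.mulLeft_apply, mulPoly_C_mul, mul_assoc]
    congr 1
    induction i with
    | zero => simp
    | succ k ih => rw [pow_succ', Module.End.mul_apply, mulPoly_dMul, ih, mul_assoc]

instance : Mul (DiffOp K) := ⟨fun P Q => ⟨mulPoly P.toPoly Q.toPoly⟩⟩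

theorem toPoly_mul (P Q : DiffOp K) : (P * Q).toPoly = mulPoly P.toPoly Q.toPoly := rfl

/-- The ring `K[∂]` of differential operators. -/
instance : Ring (DiffOp K) where
  __ := (inferInstance : AddCommGroup (DiffOp K))
  left_distrib P Q R := DiffOp.ext (map_add _ _ _)
  right_distrib P Q R := DiffOp.ext (by
    rw [toPoly_mul, toPoly_add, mulPoly_add]; rfl)
  zero_mul P := DiffOp.ext (by rw [toPoly_mul, toPoly_zero, mulPoly_zero]; rfl)
  mul_zero P := DiffOp.ext (map_zero _)
  mul_assoc P Q R := DiffOp.ext (by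
    simp only [toPoly_mul, mulPoly_mulPoly, Module.End.mul_apply])
  one_mul P := DiffOp.ext (by rw [toPoly_mul, toPoly_one, mulPoly_one]; rfl)
  mul_one P := DiffOp.ext (mulPoly_apply_one _)

/-- The operator of multiplication by `a`. -/
def const (a : K) : DiffOp K := ⟨C a⟩

/-- The operator `∂`. -/
def del : DiffOp K := ⟨X⟩

/-- The commutation rule of `K[∂]`. -/
theorem del_mul_const (a : K) :
    (DiffOp.del * const a : DiffOp K) =
      const a * DiffOp.del + const (Differential.deriv a) := by
  apply DiffOp.ext
  simp only [toPoly_mul, toPoly_add, const, DiffOp.del]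
  simp only [← monomial_one_one_eq_X, ← monomial_zero_left]
  rw [mulPoly_monomial, mulPoly_monomial]
  simp only [Module.End.mul_apply, pow_one, pow_zero, LinearMap.mulLeft_apply, dMul_apply,
    mul_one, monomial_zero_left, Differential.mapCoeffs_C, C_1, one_mul, X_mul_C,
    ← C_mul_X_eq_monomial]

/-! ### Order and leading coefficient -/

theorem natDegree_dMul_pow {q : K[X]} {m : ℕ} (hq : q.natDegree ≤ m) (i : ℕ) :
    ((dMul ^ i : Module.End ℤ K[X]) q).natDegree ≤ m + i := by
  rw [natDegree_le_iff_coeff_eq_zero] at hq ⊢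
  induction i with
  | zero => simpa using hq
  | succ k ih =>
    intro N hN
    obtain ⟨N, rfl⟩ : ∃ M, N = M + 1 := ⟨N - 1, by omega⟩
    rw [pow_succ', Module.End.mul_apply, dMul_apply, coeff_add, coeff_X_mul,
      Differential.coeff_mapCoeffs, ih N (by omega), ih (N + 1) (by omega)]
    simp

theorem coeff_dMul_pow {q : K[X]} {m : ℕ} (hq : q.natDegree ≤ m) (i : ℕ) :
    ((dMul ^ i : Module.End ℤ K[X]) q).coeff (m + i) = q.coeff m := by
  induction i with
  | zero => simp
  | succ k ih =>
    rw [pow_succ', Module.End.mul_apply, dMul_apply, ← add_assoc, coeff_add, coeff_X_mul,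
      Differential.coeff_mapCoeffs, ih,
      coeff_eq_zero_of_natDegree_lt (lt_of_le_of_lt (natDegree_dMul_pow hq k) (Nat.lt_succ_self _))]
    simp

theorem mulPoly_eq_sum {p : K[X]} {n : ℕ} (hp : p.natDegree ≤ n) (q : K[X]) :
    mulPoly p q =
      ∑ i ∈ Finset.range (n + 1), C (p.coeff i) * (dMul ^ i : Module.End ℤ K[X]) q := by
  rw [mulPoly, Polynomial.sum_over_range' p (fun i => by ext1 x; simp) (n + 1) (by omega),
    LinearMap.sum_apply]
  rfl

theorem natDegree_mulPoly_le {p q : K[X]} {n m : ℕ} (hp : p.natDegree ≤ n) (hq : q.natDegree ≤ m) :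
    (mulPoly p q).natDegree ≤ n + m := by
  rw [mulPoly_eq_sum hp]
  refine natDegree_sum_le_of_forall_le _ _ fun i hi => ?_
  refine (natDegree_C_mul_le _ _).trans ((natDegree_dMul_pow hq i).trans ?_)
  have := Finset.mem_range.1 hi
  omega

theorem coeff_mulPoly {p q : K[X]} {n m : ℕ} (hp : p.natDegree ≤ n) (hq : q.natDegree ≤ m) :
    (mulPoly p q).coeff (n + m) = p.coeff n * q.coeff m := by
  rw [mulPoly_eq_sum hp, finsetSum_coeff, Finset.sum_range_succ, coeff_C_mul, add_comm n m,
    coeff_dMul_pow hq, Finset.sum_eq_zero, zero_add]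
  intro i hi
  have := Finset.mem_range.1 hi
  rw [coeff_C_mul, coeff_eq_zero_of_natDegree_lt
    (lt_of_le_of_lt (natDegree_dMul_pow hq i) (by omega)), mul_zero]

theorem toPoly_ne_zero {P : DiffOp K} (hP : P ≠ 0) : P.toPoly ≠ 0 :=
  fun h => hP (DiffOp.ext h)

theorem mul_data {P Q : DiffOp K} (hP : P ≠ 0) (hQ : Q ≠ 0) :
    (P * Q).toPoly.natDegree = P.toPoly.natDegree + Q.toPoly.natDegree ∧
      (P * Q).toPoly.leadingCoeff = P.toPoly.leadingCoeff * Q.toPoly.leadingCoeff := by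
  have hc := coeff_mulPoly (le_refl P.toPoly.natDegree) (le_refl Q.toPoly.natDegree)
  have hne : P.toPoly.leadingCoeff * Q.toPoly.leadingCoeff ≠ 0 :=
    mul_ne_zero (leadingCoeff_ne_zero.2 (toPoly_ne_zero hP))
      (leadingCoeff_ne_zero.2 (toPoly_ne_zero hQ))
  have hd : (P * Q).toPoly.natDegree = P.toPoly.natDegree + Q.toPoly.natDegree :=
    le_antisymm (natDegree_mulPoly_le le_rfl le_rfl)
      (le_natDegree_of_ne_zero (by rw [toPoly_mul, hc]; exact hne))
  exact ⟨hd, by rw [leadingCoeff, hd, toPoly_mul, hc]; rfl⟩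

instance : Nontrivial (DiffOp K) :=
  ⟨⟨0, 1, fun h => zero_ne_one (congrArg DiffOp.toPoly h)⟩⟩

instance : NoZeroDivisors (DiffOp K) where
  eq_zero_or_eq_zero_of_mul_eq_zero {P Q} h := by
    by_contra! hPQ
    have h2 := (mul_data hPQ.1 hPQ.2).2
    rw [h, toPoly_zero, leadingCoeff_zero] at h2
    exact mul_ne_zero (leadingCoeff_ne_zero.2 (toPoly_ne_zero hPQ.1))
      (leadingCoeff_ne_zero.2 (toPoly_ne_zero hPQ.2)) h2.symm

/-! ### The skewfield of fractions -/

/-- Division with remainder by `S` on the right. -/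
theorem exists_div (R S : DiffOp K) (hS : S ≠ 0) :
    ∃ Q T : DiffOp K, R = Q * S + T ∧ T.toPoly.degree < S.toPoly.degree := by
  by_cases hRS : R.toPoly.degree < S.toPoly.degree
  · exact ⟨0, R, by simp, hRS⟩
  have hS' := toPoly_ne_zero hS
  have hR' : R.toPoly ≠ 0 := by
    intro h0
    rw [h0, degree_zero, bot_lt_iff_ne_bot] at hRS
    exact hRS (degree_ne_bot.2 hS')
  have hle : S.toPoly.natDegree ≤ R.toPoly.natDegree := natDegree_le_natDegree (not_lt.1 hRS)
  let Q₀ : DiffOp K := ⟨monomial (R.toPoly.natDegree - S.toPoly.natDegree)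
    (R.toPoly.leadingCoeff / S.toPoly.leadingCoeff)⟩
  have hQ₀ : Q₀ ≠ 0 := fun h => by
    have h' := congrArg DiffOp.toPoly h
    rw [toPoly_zero, monomial_eq_zero_iff] at h'
    exact div_ne_zero (leadingCoeff_ne_zero.2 hR') (leadingCoeff_ne_zero.2 hS') h'
  have hne : R.toPoly.leadingCoeff / S.toPoly.leadingCoeff ≠ 0 :=
    div_ne_zero (leadingCoeff_ne_zero.2 hR') (leadingCoeff_ne_zero.2 hS')
  obtain ⟨hd, hl⟩ := mul_data hQ₀ hS
  have hQd : Q₀.toPoly.natDegree = R.toPoly.natDegree - S.toPoly.natDegree :=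
    natDegree_monomial_eq _ hne
  have hQl : Q₀.toPoly.leadingCoeff = R.toPoly.leadingCoeff / S.toPoly.leadingCoeff :=
    leadingCoeff_monomial _ _
  have hlt : (R - Q₀ * S).toPoly.degree < R.toPoly.degree := by
    rw [toPoly_sub]
    refine degree_sub_lt_left ?_ hR' ?_
    · rw [degree_eq_natDegree hR', degree_eq_natDegree (toPoly_ne_zero (mul_ne_zero hQ₀ hS)),
        hd, hQd, Nat.sub_add_cancel hle]
    · rw [hl, hQl, div_mul_cancel₀ _ (leadingCoeff_ne_zero.2 hS')]
  obtain ⟨Q, T, h, hT⟩ := exists_div (R - Q₀ * S) S hS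
  exact ⟨Q₀ + Q, T, by rw [add_mul, add_assoc, ← h, add_sub_cancel], hT⟩
termination_by R.toPoly.degree

/-- Two differential operators have a common left multiple, nonzero if `S ≠ 0`. -/
theorem exists_ore (R S : DiffOp K) (hS : S ≠ 0) :
    ∃ R' S' : DiffOp K, S' ≠ 0 ∧ S' * R = R' * S := by
  obtain ⟨Q, T, h, hT⟩ := exists_div R S hS
  by_cases hT0 : T = 0
  · exact ⟨Q, 1, one_ne_zero, by rw [h, hT0]; simp⟩
  obtain ⟨R', S', hS', h'⟩ := exists_ore S T hT0
  refine ⟨R' * Q + S', R', ?_, ?_⟩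
  · rintro rfl
    rw [zero_mul] at h'
    exact mul_ne_zero hS' hS h'
  · rw [h, mul_add, ← h', add_mul, mul_assoc]
termination_by S.toPoly.degree

instance : OreLocalization.OreSet (DiffOp K)⁰ :=
  (OreLocalization.nonempty_oreSet_iff_of_noZeroDivisors.2 fun R S => by
    obtain ⟨R', S', hS', h⟩ := exists_ore R (S : DiffOp K) (nonZeroDivisors.coe_ne_zero S)
    exact ⟨R', ⟨S', mem_nonZeroDivisors_of_ne_zero hS'⟩, h⟩).some

end

end DiffOp

/-- The skewfield `K(∂)` of rational pseudodifferential operators: the skewfield of fractions of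
`K[∂]`. -/
abbrev RatOp (K : Type*) [Field K] [Differential K] : Type _ :=
  OreLocalization (DiffOp K)⁰ (DiffOp K)

/-- The values `a λᵈ` (`a ∈ K` nonzero, `d ∈ ℤ`) of the Dieudonné determinant, together with `0`.
The pair `(a, d)` stands for `a λᵈ`. -/
abbrev DetValue (K : Type*) [Field K] : Type _ :=
  WithZero (Kˣ × Multiplicative ℤ)

noncomputable section

variable {K : Type*} [Field K] [Differential K]

open Classical in
/-- `a ∂ᵈ + (terms of lower order) ↦ a λᵈ` for `a ≠ 0`, and `0 ↦ 0`. -/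
def DiffOp.symbol : DiffOp K →* DetValue K where
  toFun P := if hP : P = 0 then 0 else
    (((Units.mk0 P.toPoly.leadingCoeff (leadingCoeff_ne_zero.2 (DiffOp.toPoly_ne_zero hP)),
      Multiplicative.ofAdd (P.toPoly.natDegree : ℤ)) : Kˣ × Multiplicative ℤ) : DetValue K)
  map_one' := by
    rw [dif_neg one_ne_zero, ← WithZero.coe_one, WithZero.coe_inj]
    simp [DiffOp.toPoly_one, Prod.ext_iff]
  map_mul' P Q := by
    by_cases hP : P = 0
    · simp [hP]
    by_cases hQ : Q = 0
    · simp [hQ]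
    obtain ⟨hd, hl⟩ := DiffOp.mul_data hP hQ
    rw [dif_neg hP, dif_neg hQ, dif_neg (mul_ne_zero hP hQ), ← WithZero.coe_mul, WithZero.coe_inj]
    simp [hd, hl, ofAdd_add]

theorem DiffOp.symbol_ne_zero {P : DiffOp K} (hP : P ≠ 0) : DiffOp.symbol P ≠ 0 := by
  classical
  change (if hP : P = 0 then 0 else _) ≠ _
  rw [dif_neg hP]
  exact WithZero.coe_ne_zero

/-- The multiplicative extension of the symbol to `K(∂)`: it sends `P Q⁻¹` to the quotient of the
symbols of `P` and `Q`. -/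
def RatOp.symbol : RatOp K →* DetValue K :=
  OreLocalization.universalMulHom DiffOp.symbol
    (IsUnit.liftRight (DiffOp.symbol.comp (DiffOp K)⁰.subtype) fun S =>
      isUnit_iff_ne_zero.2 (DiffOp.symbol_ne_zero (nonZeroDivisors.coe_ne_zero S)))
    fun S => (IsUnit.coe_liftRight (DiffOp.symbol.comp (DiffOp K)⁰.subtype) _ S).symm

open Classical in
/-- The Dieudonné determinant of a square matrix over `K(∂)`, computed by Gaussian elimination with
row operations.  If the first column is zero, the determinant is zero.  Otherwise, for the first row
`i` with `A i 0 ≠ 0`, move that row to the top (which gives the sign `(-1) ^ i`), subtract left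
multiples of it from the other rows so as to clear the first column, and continue with the
remaining block. -/
def dieudonneDet : {n : ℕ} → Matrix (Fin n) (Fin n) (RatOp K) → DetValue K
  | 0, _ => 1
  | n + 1, A =>
    if h : ∃ i, A i 0 ≠ 0 then
      let i := Fin.find (fun i => A i 0 ≠ 0) h
      RatOp.symbol ((-1) ^ (i : ℕ) * A i 0) *
        dieudonneDet (Matrix.of fun r c : Fin n =>
          A (i.succAbove r) c.succ - A (i.succAbove r) 0 * (A i 0)⁻¹ * A i c.succ)
    else 0

namespace DiffOp

variable {n : ℕ}

/-- The Dieudonné determinant `det A` of a matrix differential operator `A ∈ M_n(K[∂])`, taken after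
the embedding `K[∂] ⊂ K(∂)`. -/
def det (A : Matrix (Fin n) (Fin n) (DiffOp K)) : DetValue K :=
  dieudonneDet (A.map (OreLocalization.numeratorHom : DiffOp K → RatOp K))

/-- The action of a differential operator on a function: `(∑ aᵢ ∂ⁱ) f = ∑ aᵢ f⁽ⁱ⁾`. -/
def apply (P : DiffOp K) (f : K) : K :=
  P.toPoly.sum fun i a => a * Differential.deriv^[i] f

/-- The kernel in `Kⁿ` of a matrix differential operator. -/
def ker (A : Matrix (Fin n) (Fin n) (DiffOp K)) : Set (Fin n → K) :=
  {F | ∀ i, ∑ j, (A i j).apply (F j) = 0}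

end DiffOp

end

/-! The factor $D$ is a greatest common right divisor of $A$ and $B$. Right division makes every
left ideal of $\mathcal K[\partial]$ principal, so the left submodule of $\mathcal K[\partial]^n$
generated by the rows of $A$ and $B$ is the row space of a square matrix $D$. Hence $A=A_1D$,
$B=B_1D$ and $D=UA+VB$ (`exists_right_gcd`).

Only the vanishing or non-vanishing of the determinant matters: $\det M\ne 0$ exactly when $M$ acts
injectively on columns over $\mathcal K(\partial)$, and it then acts bijectively. So $\det(B_1D)\ne
0$ passes to both factors, and $D$ can be cancelled from $(UA_1+VB_1)D=D$. The identity
$UA_1+VB_1=1$ remains, and since $\mathcal K[\partial]$ acts on $\mathcal K$ as a ring, any $F$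
killed by $A_1$ and $B_1$ is $0$. -/

noncomputable section

namespace DiffOp

/-! ### The action of operators on functions. -/

section Action

variable {K : Type*} [Field K] [Differential K]

theorem iterate_deriv_eq (i : ℕ) (f : K) :
    Differential.deriv^[i] f =
      ((Differential.deriv (R := K)).toLinearMap ^ i : Module.End ℤ K) f := by
  rw [Module.End.pow_apply]; rfl

/-- The additive endomorphism of `K` by which a differential operator acts. -/
def actEnd (p : K[X]) : Module.End ℤ K :=
  p.sum fun i a => LinearMap.mulLeft ℤ a * (Differential.deriv (R := K)).toLinearMap ^ i

theorem actEnd_add (p q : K[X]) : actEnd (p + q) = actEnd p + actEnd q :=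
  Polynomial.sum_add_index p q _
    (fun i => by ext1 x; simp)
    (fun i a b => by ext1 x; simp [add_mul])

theorem actEnd_monomial (i : ℕ) (a : K) :
    actEnd (monomial i a) =
      LinearMap.mulLeft ℤ a * (Differential.deriv (R := K)).toLinearMap ^ i :=
  Polynomial.sum_monomial_index a _ (by ext1 x; simp)

/-- This is the Leibniz rule $(af)'=af'+a'f$, the only point where the formal product must be
compared with actual composition. -/
theorem actEnd_dMul (q : K[X]) :
    actEnd (dMul q) = (Differential.deriv (R := K)).toLinearMap * actEnd q := by
  induction q using Polynomial.induction_on' with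
  | add p q hp hq => rw [map_add, actEnd_add, hp, hq, actEnd_add, mul_add]
  | monomial i a =>
    rw [dMul_apply, X_mul_monomial, Differential.mapCoeffs_monomial, actEnd_add,
      actEnd_monomial, actEnd_monomial, actEnd_monomial]
    ext1 x
    simp only [LinearMap.add_apply, Module.End.mul_apply, LinearMap.mulLeft_apply,
      pow_succ', Derivation.leibniz, smul_eq_mul,
      Derivation.coeFn_coe]
    ring

theorem actEnd_C_mul (a : K) (q : K[X]) :
    actEnd (C a * q) = LinearMap.mulLeft ℤ a * actEnd q := by
  induction q using Polynomial.induction_on' with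
  | add p q hp hq => rw [mul_add, actEnd_add, hp, hq, actEnd_add, mul_add]
  | monomial i b =>
    rw [C_mul_monomial, actEnd_monomial, actEnd_monomial]
    ext1 x
    simp

theorem actEnd_mulPoly (p q : K[X]) : actEnd (mulPoly p q) = actEnd p * actEnd q := by
  induction p using Polynomial.induction_on' with
  | add p p' hp hq => rw [mulPoly_add, LinearMap.add_apply, actEnd_add, hp, hq, actEnd_add, add_mul]
  | monomial i a =>
    rw [mulPoly_monomial, actEnd_monomial, Module.End.mul_apply, LinearMap.mulLeft_apply,
      actEnd_C_mul, mul_assoc]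
    congr 1
    induction i with
    | zero => simp
    | succ k ih => rw [pow_succ', Module.End.mul_apply, actEnd_dMul, ih, pow_succ', mul_assoc]

theorem actEnd_one : actEnd (1 : K[X]) = 1 := by
  rw [← monomial_zero_one, actEnd_monomial]; ext1 x; simp

/-- The action of `K[∂]` on `K`, as a ring homomorphism. -/
def act : DiffOp K →+* Module.End ℤ K where
  toFun P := actEnd P.toPoly
  map_one' := actEnd_one
  map_mul' P Q := actEnd_mulPoly P.toPoly Q.toPoly
  map_zero' := Polynomial.sum_zero_index _
  map_add' P Q := actEnd_add P.toPoly Q.toPoly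

theorem apply_eq_act (P : DiffOp K) (f : K) : P.apply f = act P f := by
  change _ = actEnd P.toPoly f
  simp only [apply, actEnd, Polynomial.sum_def, LinearMap.sum_apply, Module.End.mul_apply,
    LinearMap.mulLeft_apply, iterate_deriv_eq]

/-- Multiplying on the left can only enlarge the kernel, because $(UA)F=U(AF)$. -/
theorem sum_act_mul {n : ℕ} (U A : Matrix (Fin n) (Fin n) (DiffOp K)) {F : Fin n → K}
    (hF : F ∈ ker A) (i : Fin n) : ∑ j, act ((U * A) i j) (F j) = 0 := by
  have hF' : ∀ k, ∑ j, act (A k j) (F j) = 0 := fun k => by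
    simpa only [apply_eq_act] using hF k
  calc ∑ j, act ((U * A) i j) (F j)
      = ∑ j, ∑ k, act (U i k) (act (A k j) (F j)) := by
        simp only [Matrix.mul_apply, map_sum, map_mul, LinearMap.sum_apply, Module.End.mul_apply]
    _ = ∑ k, act (U i k) (∑ j, act (A k j) (F j)) := by
        rw [Finset.sum_comm]; simp only [map_sum]
    _ = 0 := by simp only [hF', map_zero, Finset.sum_const_zero]

theorem zero_mem_ker {n : ℕ} (A : Matrix (Fin n) (Fin n) (DiffOp K)) : (0 : Fin n → K) ∈ ker A :=
  fun i => by simp [apply_eq_act]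

/-- A left Bézout identity forces the kernels to intersect trivially. -/
theorem ker_inter_ker_eq_zero {n : ℕ} {U V A B : Matrix (Fin n) (Fin n) (DiffOp K)}
    (h : U * A + V * B = 1) : ker A ∩ ker B = {0} := by
  refine Set.eq_singleton_iff_unique_mem.2 ⟨⟨zero_mem_ker A, zero_mem_ker B⟩, ?_⟩
  rintro F ⟨hA, hB⟩
  funext i
  have h1 : ∑ j, act ((U * A + V * B) i j) (F j) = 0 := by
    simp only [Matrix.add_apply, map_add, LinearMap.add_apply, Finset.sum_add_distrib,
      sum_act_mul U A hA, sum_act_mul V B hB, add_zero]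
  rw [h, Finset.sum_eq_single i (fun j _ hj => by simp [Matrix.one_apply_ne hj.symm])
    (by simp), Matrix.one_apply_eq, map_one, Module.End.one_apply] at h1
  exact h1

end Action

/-! ### Principal left ideals and row spaces. -/

instance isPrincipalIdealRing {K : Type*} [Field K] [Differential K] :
    IsPrincipalIdealRing (DiffOp K) where
  principal I := by
    by_cases hI : ∃ P ∈ I, P ≠ 0
    -- A nonzero element of least order generates: the remainder on dividing by it stays in the
    -- ideal and has smaller order.
    · obtain ⟨S, ⟨hSI, hS0⟩, hmin⟩ := (measure fun P : DiffOp K => P.toPoly.natDegree).wf.has_min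
        {P | P ∈ I ∧ P ≠ 0} hI
      refine ⟨⟨S, le_antisymm (fun R hR => ?_) ((Submodule.span_singleton_le_iff_mem _ _).2 hSI)⟩⟩
      obtain ⟨Q, T, h, hT⟩ := exists_div R S hS0
      have hTI : T ∈ I := by
        rw [eq_sub_of_add_eq' h.symm]
        exact I.sub_mem hR (I.mul_mem_left Q hSI)
      have hT0 : T = 0 := by
        by_contra hT0
        exact hmin T ⟨hTI, hT0⟩ (natDegree_lt_natDegree (toPoly_ne_zero hT0) hT)
      rw [h, hT0, add_zero]
      exact Submodule.mem_span_singleton.2 ⟨Q, rfl⟩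
    · push Not at hI
      exact ⟨⟨0, by rw [(Submodule.eq_bot_iff I).2 hI, Submodule.span_singleton_eq_bot.2 rfl]⟩⟩

end DiffOp

/-- Over a ring all of whose left ideals are principal, every submodule of the free left module of
rank `n` is the row space of a square matrix. -/
theorem exists_matrix_row_span {R : Type*} [Ring R] [IsPrincipalIdealRing R] :
    ∀ {n : ℕ} (N : Submodule R (Fin n → R)), ∃ D : Matrix (Fin n) (Fin n) R,
      (∀ i, D i ∈ N) ∧ ∀ w ∈ N, ∃ v, Matrix.vecMul v D = w
  | 0, N => ⟨0, fun i => i.elim0, fun w _ => ⟨0, Subsingleton.elim _ _⟩⟩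
  | n + 1, N => by
    let consZero : (Fin n → R) →ₗ[R] (Fin (n + 1) → R) :=
      { toFun := fun w => Fin.cons 0 w
        map_add' := fun v w => by
          funext i; refine Fin.cases ?_ (fun j => ?_) i <;> simp
        map_smul' := fun c w => by
          funext i; refine Fin.cases ?_ (fun j => ?_) i <;> simp }
    obtain ⟨D', hD'N, hD'⟩ := exists_matrix_row_span (N.comap consZero)
    -- The first coordinates of `N` form a left ideal with generator `d`. With `v₀ ∈ N` lifting `d`,
    -- `N` is the sum of `R v₀` and its vectors with first coordinate zero. The case `d = 0` needs
    -- no separate treatment, as the rows need not be independent.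
    obtain ⟨⟨d, hd⟩⟩ := IsPrincipalIdealRing.principal (N.map (LinearMap.proj (0 : Fin (n + 1))))
    have hdmem : d ∈ N.map (LinearMap.proj (R := R) (φ := fun _ => R) (0 : Fin (n + 1))) := by
      rw [hd]; exact Submodule.mem_span_singleton_self d
    obtain ⟨v₀, hv₀, hv₀d⟩ := Submodule.mem_map.1 hdmem
    have hv₀d' : v₀ 0 = d := hv₀d
    refine ⟨Matrix.of (Fin.cons v₀ fun i => consZero (D' i)), fun i => ?_, fun w hw => ?_⟩
    · refine Fin.cases hv₀ (fun j => ?_) i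
      exact hD'N j
    · have hw0 : w 0 ∈ Submodule.span R {d} := hd ▸ Submodule.mem_map_of_mem hw
      obtain ⟨c, hc⟩ := Submodule.mem_span_singleton.1 hw0
      have htail : consZero (fun j : Fin n => w j.succ - c * v₀ j.succ) = w - c • v₀ := by
        funext i
        refine Fin.cases ?_ (fun j => ?_) i
        · simp [consZero, hv₀d', ← hc]
        · simp [consZero]
      obtain ⟨u, hu⟩ := hD' (fun j => w j.succ - c * v₀ j.succ) (by
        rw [Submodule.mem_comap, htail]
        exact N.sub_mem hw (N.smul_mem c hv₀))
      refine ⟨Fin.cons c u, ?_⟩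
      funext k
      simp only [Matrix.vecMul, dotProduct, Fin.sum_univ_succ, Fin.cons_zero, Fin.cons_succ,
        Matrix.of_apply]
      refine Fin.cases ?_ (fun j => ?_) k
      · simp [consZero, hv₀d', ← hc]
      · have := congrFun hu j
        simp only [Matrix.vecMul, dotProduct] at this
        simp [consZero, this]

/-! ### Non-vanishing of the determinant and invertibility over the skewfield. -/

section Determinant

variable {K : Type*} [Field K] [Differential K]

theorem RatOp.symbol_ne_zero {x : RatOp K} (hx : x ≠ 0) : RatOp.symbol x ≠ 0 :=
  ((isUnit_iff_ne_zero.2 hx).map RatOp.symbol).ne_zero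

end Determinant

section Schur

variable {L : Type*} [DivisionRing L] {n : ℕ}

/-- The block that remains after clearing the first column with row `i`. -/
def schurBlock (A : Matrix (Fin (n + 1)) (Fin (n + 1)) L) (i : Fin (n + 1)) :
    Matrix (Fin n) (Fin n) L :=
  Matrix.of fun r c => A (i.succAbove r) c.succ - A (i.succAbove r) 0 * (A i 0)⁻¹ * A i c.succ

/-- One step of elimination: the pivot row `i` determines `v 0`, and substituting this into the
other rows leaves a system in the remaining unknowns. Coefficients stay on the left of unknowns, so
commutativity is not needed. -/
theorem mulVec_eq_iff_schurBlock {A : Matrix (Fin (n + 1)) (Fin (n + 1)) L} {i : Fin (n + 1)}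
    (hi : A i 0 ≠ 0) (v w : Fin (n + 1) → L) :
    A.mulVec v = w ↔
      v 0 = (A i 0)⁻¹ * (w i - ∑ c : Fin n, A i c.succ * v c.succ) ∧
      (schurBlock A i).mulVec (fun c => v c.succ) =
        fun r => w (i.succAbove r) - A (i.succAbove r) 0 * (A i 0)⁻¹ * w i := by
  have hrow : ∀ k, A.mulVec v k = A k 0 * v 0 + ∑ c : Fin n, A k c.succ * v c.succ := fun k => by
    simp only [Matrix.mulVec, dotProduct, Fin.sum_univ_succ]
  have hS : ∀ r, (schurBlock A i).mulVec (fun c => v c.succ) r =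
      ∑ c : Fin n, A (i.succAbove r) c.succ * v c.succ -
        A (i.succAbove r) 0 * (A i 0)⁻¹ * ∑ c : Fin n, A i c.succ * v c.succ := fun r => by
    simp only [Matrix.mulVec, dotProduct, schurBlock, Matrix.of_apply, sub_mul,
      Finset.sum_sub_distrib, Finset.mul_sum, mul_assoc]
  have hpivot : A.mulVec v i = w i ↔
      v 0 = (A i 0)⁻¹ * (w i - ∑ c : Fin n, A i c.succ * v c.succ) := by
    rw [hrow, eq_inv_mul_iff_mul_eq₀ hi, eq_sub_iff_add_eq]
  rw [funext_iff, Fin.forall_iff_succAbove i, hpivot, funext_iff]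
  refine and_congr_right fun h0 => forall_congr' fun r => ?_
  rw [hrow, hS, h0, mul_sub, mul_sub, ← mul_assoc, ← mul_assoc]
  constructor
  · intro h; rw [← h]; abel
  · intro h; rw [eq_sub_iff_add_eq] at h; rw [← h]; abel

end Schur

section Determinant

variable {K : Type*} [Field K] [Differential K]

/-- By induction on the size: the Schur block is bijective, and the pivot equation fixes the first
unknown uniquely. -/
theorem dieudonneDet_ne_zero_bijective :
    ∀ {n : ℕ} {A : Matrix (Fin n) (Fin n) (RatOp K)}, dieudonneDet A ≠ 0 →
      Function.Bijective A.mulVec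
  | 0, _, _ => ⟨fun _ _ _ => Subsingleton.elim _ _, fun _ => ⟨0, Subsingleton.elim _ _⟩⟩
  | n + 1, A, hA => by
    classical
    by_cases h : ∃ i, A i 0 ≠ 0
    · rw [dieudonneDet, dif_pos h] at hA
      set i := Fin.find (fun i => A i 0 ≠ 0) h
      have hi : A i 0 ≠ 0 := Fin.find_spec h
      have hS := dieudonneDet_ne_zero_bijective (A := schurBlock A i) (right_ne_zero_of_mul hA)
      refine ⟨fun v v' hv => ?_, fun w => ?_⟩
      · obtain ⟨h0, h1⟩ := (mulVec_eq_iff_schurBlock hi v _).1 rfl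
        obtain ⟨h0', h1'⟩ := (mulVec_eq_iff_schurBlock hi v' _).1 hv.symm
        have htail := hS.1 (h1.trans h1'.symm)
        funext k
        refine Fin.cases ?_ (fun j => congrFun htail j) k
        rw [h0, h0']
        simp only [fun j => congrFun htail j]
      · obtain ⟨u, hu⟩ := hS.2
          fun r => w (i.succAbove r) - A (i.succAbove r) 0 * (A i 0)⁻¹ * w i
        refine ⟨Fin.cons ((A i 0)⁻¹ * (w i - ∑ c : Fin n, A i c.succ * u c)) u, ?_⟩
        rw [mulVec_eq_iff_schurBlock hi]
        simpa using hu
    · rw [dieudonneDet, dif_neg h] at hA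
      exact absurd rfl hA

theorem dieudonneDet_ne_zero_of_injective :
    ∀ {n : ℕ} {A : Matrix (Fin n) (Fin n) (RatOp K)},
      (∀ v, A.mulVec v = 0 → v = 0) → dieudonneDet A ≠ 0
  | 0, _, _ => by rw [dieudonneDet]; exact one_ne_zero
  | n + 1, A, hA => by
    classical
    by_cases h : ∃ i, A i 0 ≠ 0
    · rw [dieudonneDet, dif_pos h]
      set i := Fin.find (fun i => A i 0 ≠ 0) h
      have hi : A i 0 ≠ 0 := Fin.find_spec h
      refine mul_ne_zero (RatOp.symbol_ne_zero
        (mul_ne_zero (pow_ne_zero _ (neg_ne_zero.2 one_ne_zero)) hi)) ?_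
      refine dieudonneDet_ne_zero_of_injective (A := schurBlock A i) fun u hu => ?_
      -- A kernel vector of the block extends to one of `A`, with first entry forced by the pivot
      -- equation.
      have hv := hA (Fin.cons ((A i 0)⁻¹ * (0 - ∑ c : Fin n, A i c.succ * u c)) u) (by
        rw [mulVec_eq_iff_schurBlock hi]
        refine ⟨by simp, ?_⟩
        simp only [Fin.cons_succ, Pi.zero_apply, mul_zero, sub_zero]
        exact hu)
      funext j
      simpa using congrFun hv j.succ
    · push Not at h
      -- A zero first column puts the first basis vector in the kernel.
      have hv := hA (Pi.single 0 1) (by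
        funext k
        rw [Matrix.mulVec_single_one]
        exact h k)
      exact absurd (congrFun hv 0) (by simp)

end Determinant

/-! ### Cancellation and common divisors of matrices over $\mathcal K[\partial]$. -/

namespace DiffOp

variable {K : Type*} [Field K] [Differential K] {n : ℕ}

/-- The embedding `M_n(K[∂]) ⊂ M_n(K(∂))`. -/
def matEmb : Matrix (Fin n) (Fin n) (DiffOp K) →+* Matrix (Fin n) (Fin n) (RatOp K) :=
  (OreLocalization.numeratorRingHom : DiffOp K →+* RatOp K).mapMatrix

theorem matEmb_injective :
    Function.Injective (matEmb : Matrix (Fin n) (Fin n) (DiffOp K) → _) :=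
  Matrix.map_injective (OreLocalization.numeratorHom_inj fun _ h => h.1)

theorem det_ne_zero_iff_injective (A : Matrix (Fin n) (Fin n) (DiffOp K)) :
    det A ≠ 0 ↔ ∀ v, (matEmb A).mulVec v = 0 → v = 0 :=
  ⟨fun h _ hv => (dieudonneDet_ne_zero_bijective h).1 (hv.trans (Matrix.mulVec_zero _).symm),
    fun h => dieudonneDet_ne_zero_of_injective h⟩

theorem mulVec_matEmb_surjective {A : Matrix (Fin n) (Fin n) (DiffOp K)} (hA : det A ≠ 0) :
    Function.Surjective (matEmb A).mulVec :=
  (dieudonneDet_ne_zero_bijective hA).2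

theorem det_ne_zero_of_mul {A B : Matrix (Fin n) (Fin n) (DiffOp K)} (h : det (A * B) ≠ 0) :
    det A ≠ 0 ∧ det B ≠ 0 := by
  rw [det_ne_zero_iff_injective, map_mul] at h
  have hB : det B ≠ 0 := (det_ne_zero_iff_injective B).2 fun v hv =>
    h v (by rw [← Matrix.mulVec_mulVec, hv, Matrix.mulVec_zero])
  refine ⟨(det_ne_zero_iff_injective A).2 fun u hu => ?_, hB⟩
  -- Injectivity of the product gives that of `B`, hence surjectivity; so a kernel vector of `A` has
  -- the form `B v`.
  obtain ⟨v, rfl⟩ := mulVec_matEmb_surjective hB u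
  rw [h v (by rw [← Matrix.mulVec_mulVec, hu]), Matrix.mulVec_zero]

theorem mul_right_cancel_of_det_ne_zero {A B D : Matrix (Fin n) (Fin n) (DiffOp K)}
    (hD : det D ≠ 0) (h : A * D = B * D) : A = B := by
  refine matEmb_injective (Matrix.ext_of_mulVec_single fun i => ?_)
  -- Over the skewfield each basis vector lies in the image of `D`, where `A` and `B` agree.
  obtain ⟨v, hv⟩ := mulVec_matEmb_surjective hD (Pi.single i 1)
  rw [← hv, Matrix.mulVec_mulVec, Matrix.mulVec_mulVec, ← map_mul, ← map_mul, h]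

/-- Greatest common right divisors of square matrices over `K[∂]`, with a Bézout identity. -/
theorem exists_right_gcd (A B : Matrix (Fin n) (Fin n) (DiffOp K)) :
    ∃ A₁ B₁ D U V : Matrix (Fin n) (Fin n) (DiffOp K),
      A = A₁ * D ∧ B = B₁ * D ∧ U * A + V * B = D := by
  obtain ⟨D, hDN, hD⟩ := exists_matrix_row_span
    (LinearMap.range (Matrix.vecMulLinear A) ⊔ LinearMap.range (Matrix.vecMulLinear B))
  have hrow : ∀ (M : Matrix (Fin n) (Fin n) (DiffOp K)) (i : Fin n),
      M i ∈ LinearMap.range (Matrix.vecMulLinear M) := fun M i =>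
    ⟨Pi.single i 1, Matrix.single_one_vecMul i M⟩
  choose a ha using fun i => hD (A i) (Submodule.mem_sup_left (hrow A i))
  choose b hb using fun i => hD (B i) (Submodule.mem_sup_right (hrow B i))
  have hD' : ∀ i, ∃ u v, Matrix.vecMul u A + Matrix.vecMul v B = D i := fun i => by
    obtain ⟨_, ⟨u, rfl⟩, _, ⟨v, rfl⟩, h⟩ := Submodule.mem_sup.1 (hDN i)
    exact ⟨u, v, h⟩
  choose u v huv using hD'
  exact ⟨Matrix.of a, Matrix.of b, D, Matrix.of u, Matrix.of v,
    funext fun i => (ha i).symm, funext fun i => (hb i).symm, funext huv⟩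

end DiffOp

end

theorem theorem4p4 {K : Type*} [Field K] [CharZero K] [Differential K] (n : ℕ)
    (A B : Matrix (Fin n) (Fin n) (DiffOp K)) (hB : DiffOp.det B ≠ 0) :
    ∃ A₁ B₁ D : Matrix (Fin n) (Fin n) (DiffOp K),
      DiffOp.det B₁ ≠ 0 ∧ DiffOp.det D ≠ 0 ∧
      A = A₁ * D ∧ B = B₁ * D ∧
      DiffOp.ker A₁ ∩ DiffOp.ker B₁ = {0} := by
  obtain ⟨A₁, B₁, D, U, V, hA₁, hB₁, hUV⟩ := DiffOp.exists_right_gcd A B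
  obtain ⟨hdB₁, hdD⟩ := DiffOp.det_ne_zero_of_mul (hB₁ ▸ hB)
  refine ⟨A₁, B₁, D, hdB₁, hdD, hA₁, hB₁, DiffOp.ker_inter_ker_eq_zero (U := U) (V := V) ?_⟩
  -- The Bézout identity for $A_1,B_1$ is checked after multiplication by $D$ on the right.
  refine DiffOp.mul_right_cancel_of_det_ne_zero hdD ?_
  rw [add_mul, mul_assoc, mul_assoc, ← hA₁, ← hB₁, hUV, one_mul]
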